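/- For $a,q\in\mathbb C$ with $0<|q|<1$ put $(a;q)_\infty=\prod_{k\ge 0}(1-aq^k)$, and for $n\in\mathbb Z$ let $(a;q)_n=(a;q)_\infty/(aq^n;q)_\infty$, that is, $(a;q)_n=\prod_{k=0}^{n-1}(1-aq^k)$ for $n\ge 0$ and $(a;q)_{-m}=\prod_{k=1}^{m}(1-aq^{-k})^{-1}$ for $m\ge 1$; write $(a,b;q)_n=(a;q)_n(b;q)_n$ for $n\in\mathbb Z\cup\{\infty\}$. **Theorem.** Let $q,x,y\in\mathbb C$ with $0<|q|<1$ and $x,y\ne 0$, and suppose that none of $x$, $y$, $xy$ is of the form $q^{k}$ with an integer $k\ge 1$. Then the series below all converge absolutely, and $$\sum_{n=0}^{\infty}\frac{(x,y;q)_n}{(q;q)_{2n}}\left(\frac1{xy}\right)^n(q^n-1)\,q^{n^2}=(S_1-S_2-T_1+T_2)\,\frac{(q/x,q/y;q)_\infty}{(q,q/(xy);q)_\infty},$$ where $$S_1=\sum_{n\in\mathbb Z}\frac{(x,y;q)_{3n}}{(q/x,q/y;q)_{3n}}\left(\frac1{xy}\right)^{3n}q^{3n^2+2n},\qquad S_2=\sum_{n\in\mathbb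 Z}\frac{(x,y;q)_{3n}}{(q/x,q/y;q)_{3n}}\left(\frac1{xy}\right)^{3n}q^{3n^2+n},$$ $$T_1=\sum_{n\in\mathbb Z}\frac{(x,y;q)_{3n+1}}{(q/x,q/y;q)_{3n+1}}\left(\frac1{xy}\right)^{3n+1}q^{3n^2+4n+1},\qquad T_2=\sum_{n\in\mathbb Z}\frac{(x,y;q)_{3n+2}}{(q/x,q/y;q)_{3n+2}}\left(\frac1{xy}\right)^{3n+2}q^{3n^2+5n+2}.$$ (If $x$ or $y$ is $q^{-k}$ with $k\ge 0$, then $(q/x;q)_{-m}$ or $(q/y;q)_{-m}$ has a pole for $m>k$, and the terms with this factor in the denominator are read as $0$.) -/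

import Mathlib

namespace QBailey

/-- The infinite `q`-shifted factorial `(a; q)_∞ = ∏_{k ≥ 0} (1 - a q^k)`. -/
noncomputable def qPochInf (a q : ℂ) : ℂ := ∏' k : ℕ, (1 - a * q ^ k)

/-- The `q`-shifted factorial `(a; q)_n` for `n ∈ ℤ`:
`(a; q)_n = ∏_{k=0}^{n-1} (1 - a q^k)` for `n ≥ 0`, and
`(a; q)_{-m} = 1 / ∏_{k=1}^{m} (1 - a q^{-k})` for `m ≥ 1`.
This is `(a; q)_∞ / (a q^n; q)_∞`, see `qPoch_eq_div`. -/
noncomputable def qPoch (a q : ℂ) : ℤ → ℂ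
  | Int.ofNat n => ∏ k ∈ Finset.range n, (1 - a * q ^ k)
  | Int.negSucc m => (∏ k ∈ Finset.range (m + 1), (1 - a * q ^ (-((k : ℤ) + 1))))⁻¹

/-- The product that defines `(a; q)_∞` converges. -/
theorem multipliable_qPochInf (a : ℂ) {q : ℂ} (hq : ‖q‖ < 1) :
    Multipliable fun k : ℕ => 1 - a * q ^ k := by
  have h : Summable fun k : ℕ => ‖-(a * q ^ k)‖ := by
    simpa [norm_mul, norm_pow] using
      (summable_geometric_of_lt_one (norm_nonneg q) hq).mul_left ‖a‖
  simpa [sub_eq_add_neg] using multipliable_one_add_of_summable h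

theorem qPochInf_eq_prod_mul (a : ℂ) {q : ℂ} (hq : ‖q‖ < 1) (n : ℕ) :
    qPochInf a q = (∏ k ∈ Finset.range n, (1 - a * q ^ k)) * qPochInf (a * q ^ n) q := by
  induction n with
  | zero => simp
  | succ n ih =>
    have h : qPochInf (a * q ^ n) q = (1 - a * q ^ n) * qPochInf (a * q ^ (n + 1)) q := by
      have h1 := multipliable_qPochInf (a * q ^ (n + 1)) hq
      unfold qPochInf
      rw [tprod_eq_zero_mul' (by
        refine h1.congr fun k => ?_
        ring)]
      congr 1
      · simp
      · refine tprod_congr fun k => ?_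
        ring
    rw [ih, h, Finset.prod_range_succ, mul_assoc]

/-- `(a; q)_n = (a; q)_∞ / (a q^n; q)_∞` whenever this quotient makes sense. -/
theorem qPoch_eq_div (a : ℂ) {q : ℂ} (hq0 : q ≠ 0) (hq : ‖q‖ < 1) (n : ℤ)
    (h : qPochInf (a * q ^ n) q ≠ 0) :
    qPoch a q n = qPochInf a q / qPochInf (a * q ^ n) q := by
  cases n with
  | ofNat n =>
    have h' : qPochInf (a * q ^ n) q ≠ 0 := by simpa using h
    have e := qPochInf_eq_prod_mul a hq n
    simp only [qPoch, Int.ofNat_eq_natCast, zpow_natCast]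
    rw [e, mul_div_cancel_right₀ _ h']
  | negSucc m =>
    have e := qPochInf_eq_prod_mul (a * q ^ (Int.negSucc m)) hq (m + 1)
    have e1 : a * q ^ (Int.negSucc m) * q ^ (m + 1) = a := by
      rw [zpow_negSucc, mul_assoc, inv_mul_cancel₀ (pow_ne_zero _ hq0), mul_one]
    have e2 : ∏ k ∈ Finset.range (m + 1), (1 - a * q ^ (Int.negSucc m) * q ^ k)
        = ∏ k ∈ Finset.range (m + 1), (1 - a * q ^ (-((k : ℤ) + 1))) := by
      rw [← Finset.prod_range_reflect]
      refine Finset.prod_congr rfl fun k hk => ?_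
      have hk' : k ≤ m := by
        have := Finset.mem_range.mp hk
        omega
      rw [mul_assoc, ← zpow_natCast, ← zpow_add₀ hq0]
      congr 3
      rw [Int.negSucc_eq]
      have : m + 1 - 1 - k = m - k := by omega
      rw [this, Nat.cast_sub hk']
      ring
    rw [e1, e2] at e
    simp only [qPoch]
    rw [e] at h ⊢
    rw [mul_comm, div_mul_cancel_left₀ (right_ne_zero_of_mul h)]

/-- `(x, y; q)_m / (q/x, q/y; q)_m * (1/(xy))^m` for `m ∈ ℤ`. -/
noncomputable def coeff (q x y : ℂ) (m : ℤ) : ℂ :=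
  (qPoch x q m * qPoch y q m) / (qPoch (q / x) q m * qPoch (q / y) q m) * (1 / (x * y)) ^ m

/-- The general term of the unilateral series. -/
noncomputable def lhsTerm (q x y : ℂ) (n : ℕ) : ℂ :=
  (qPoch x q n * qPoch y q n) / qPoch q q (2 * n) * (1 / (x * y)) ^ n * (q ^ n - 1) * q ^ (n ^ 2)

/-- The general term of `S₁`. -/
noncomputable def S₁Term (q x y : ℂ) (n : ℤ) : ℂ :=
  coeff q x y (3 * n) * q ^ (3 * n ^ 2 + 2 * n)

/-- The general term of `S₂`. -/
noncomputable def S₂Term (q x y : ℂ) (n : ℤ) : ℂ :=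
  coeff q x y (3 * n) * q ^ (3 * n ^ 2 + n)

/-- The general term of `T₁`. -/
noncomputable def T₁Term (q x y : ℂ) (n : ℤ) : ℂ :=
  coeff q x y (3 * n + 1) * q ^ (3 * n ^ 2 + 4 * n + 1)

/-- The general term of `T₂`. -/
noncomputable def T₂Term (q x y : ℂ) (n : ℤ) : ℂ :=
  coeff q x y (3 * n + 2) * q ^ (3 * n ^ 2 + 5 * n + 2)

end QBailey

namespace QBailey

/-! This is Bailey's lemma at `a = 1` with `β_n = (q^{n²} - q^{n²-n}) / (q;q)_{2n}`; the factor `q^n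
- 1` of the left side is absorbed by writing `(1/(xy))^n` as `q^{-n} (q/(xy))^n`. Expanding `β_n =
∑_r α_r / ((q;q)_{n-r} (q;q)_{n+r})` requires `α` to be supported on explicit classes mod 3:
`cubicSum_sub_cubicSum_even` expands `q^{n²} / (q;q)_{2n}` and yields `S₁ - T₁`, while
`cubicSum_sub_cubicSum_odd` expands `q^{n²-n} / (q;q)_{2n}` and yields `S₂ - T₂`. Both follow from
recurrences given by the `q`-Pascal rule.

Each kernel `1 / ((q;q)_{n-r} (q;q)_{n+r})`, weighted by `(q/(xy);q)_{N-n} / (q;q)_{N-n}`, is summed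
over `n ≤ N` by `q`-Pfaff–Saalschütz (`sum_mul_invQFact_mul`). Dominated convergence as `N → ∞` then
gives the theorem. -/

/-! ### Reciprocal `q`-factorials and the `q`-Pascal rule. -/

/-- The reciprocal `1 / (q; q)_n`, which is `0` for negative `n`. -/
noncomputable def invQFact (q : ℂ) (n : ℤ) : ℂ := (qPoch q q n)⁻¹

theorem qPoch_natCast (a q : ℂ) (n : ℕ) :
    qPoch a q (n : ℤ) = ∏ k ∈ Finset.range n, (1 - a * q ^ k) := rfl

theorem qPoch_zero (a q : ℂ) : qPoch a q 0 = 1 := by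
  simpa using qPoch_natCast a q 0

theorem qPoch_natCast_succ (a q : ℂ) (n : ℕ) :
    qPoch a q ((n + 1 : ℕ) : ℤ) = qPoch a q (n : ℤ) * (1 - a * q ^ n) := by
  simp only [qPoch_natCast, Finset.prod_range_succ]

theorem one_sub_mul_pow_ne_zero {q : ℂ} (hq : ‖q‖ < 1) (k : ℕ) :
    1 - q * q ^ k ≠ 0 := by
  intro h
  have h1 : q ^ (k + 1) = 1 := by rw [pow_succ']; exact (sub_eq_zero.mp h).symm
  have h2 : ‖q‖ ^ (k + 1) < 1 := pow_lt_one₀ (norm_nonneg q) hq (by omega)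
  rw [← norm_pow, h1] at h2
  simp at h2

theorem qPoch_natCast_ne_zero {a q : ℂ} (h : ∀ k : ℕ, 1 - a * q ^ k ≠ 0) (n : ℕ) :
    qPoch a q (n : ℤ) ≠ 0 :=
  Finset.prod_ne_zero_iff.mpr fun k _ => h k

theorem invQFact_of_neg {q : ℂ} (hq0 : q ≠ 0) {n : ℤ} (hn : n < 0) : invQFact q n = 0 := by
  obtain ⟨m, rfl⟩ := Int.eq_negSucc_of_lt_zero hn
  -- At negative index `qPoch` is an inverted product; inverting again leaves the product itself,
  -- whose factor at `k = 0` is `1 - q * q⁻¹ = 0`.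
  simp only [invQFact, qPoch, inv_inv]
  exact Finset.prod_eq_zero (Finset.mem_range.mpr (Nat.succ_pos m)) (by simp [hq0])

theorem invQFact_zero (q : ℂ) : invQFact q 0 = 1 := by simp [invQFact, qPoch_zero]

theorem invQFact_sub_one {q : ℂ} (hq0 : q ≠ 0) (hq : ‖q‖ < 1) (n : ℤ) :
    invQFact q (n - 1) = (1 - q ^ n) * invQFact q n := by
  rcases lt_trichotomy n 0 with h | rfl | h
  · rw [invQFact_of_neg hq0 h, invQFact_of_neg hq0 (by omega), mul_zero]
  · rw [invQFact_of_neg hq0 (by omega)]; simp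
  · obtain ⟨m, rfl⟩ : ∃ m : ℕ, n = ((m + 1 : ℕ) : ℤ) := ⟨(n - 1).toNat, by omega⟩
    have e : ((m + 1 : ℕ) : ℤ) - 1 = (m : ℤ) := by push_cast; ring
    rw [e, invQFact, invQFact, qPoch_natCast_succ, mul_inv, zpow_natCast, pow_succ']
    field_simp [one_sub_mul_pow_ne_zero hq m]

/-- The `q`-Pascal rule for products of reciprocal `q`-factorials. -/
theorem one_sub_zpow_mul_invQFact_mul {q : ℂ} (hq0 : q ≠ 0) (hq : ‖q‖ < 1) (k l : ℤ) :
    (1 - q ^ (k + l)) * (invQFact q k * invQFact q l) =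
      invQFact q k * invQFact q (l - 1) + q ^ l * (invQFact q (k - 1) * invQFact q l) := by
  rw [invQFact_sub_one hq0 hq, invQFact_sub_one hq0 hq, zpow_add₀ hq0]
  ring

theorem one_sub_zpow_mul_invQFact_mul' {q : ℂ} (hq0 : q ≠ 0) (hq : ‖q‖ < 1) (k l : ℤ) :
    (1 - q ^ (k + l)) * (invQFact q k * invQFact q l) =
      q ^ k * (invQFact q k * invQFact q (l - 1)) + invQFact q (k - 1) * invQFact q l := by
  rw [invQFact_sub_one hq0 hq, invQFact_sub_one hq0 hq, zpow_add₀ hq0]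
  ring

/-! ### Sums with quadratic exponent over a class mod 3. -/

/-- A series whose terms carry `1 / ((q; q)_{k - 3j} (q; q)_{l + 3j})` has finitely many nonzero
terms. -/
theorem summable_mul_invQFact {q : ℂ} (hq0 : q ≠ 0) (a : ℤ → ℂ) (k l : ℤ) :
    Summable fun j : ℤ => a j * (invQFact q (k - 3 * j) * invQFact q (l + 3 * j)) := by
  refine summable_of_ne_finset_zero (s := Finset.Icc (-|l|) |k|) fun j hj => ?_
  rw [Finset.mem_Icc, not_and_or, not_le, not_le] at hj
  rcases hj with h | h
  · rw [invQFact_of_neg hq0 (n := l + 3 * j) (by grind)]; simp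
  · rw [invQFact_of_neg hq0 (n := k - 3 * j) (by grind)]; simp

/-- `∑_j q^{e(j)} / ((q; q)_{k - 3j} (q; q)_{l + 3j})`. -/
noncomputable def cubicSum (q : ℂ) (e : ℤ → ℤ) (k l : ℤ) : ℂ :=
  ∑' j : ℤ, q ^ e j * (invQFact q (k - 3 * j) * invQFact q (l + 3 * j))

theorem cubicSum_neg (q : ℂ) (e e' : ℤ → ℤ) (k l : ℤ) (h : ∀ j, e (-j) = e' j) :
    cubicSum q e k l = cubicSum q e' l k := by
  unfold cubicSum
  rw [← (Equiv.neg ℤ).tsum_eq]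
  refine tsum_congr fun j => ?_
  simp only [Equiv.neg_apply, h]
  rw [mul_comm (invQFact q _)]
  congr 3 <;> ring_nf

theorem cubicSum_add_one (q : ℂ) (e e' : ℤ → ℤ) (k l : ℤ) (h : ∀ j, e (j + 1) = e' j) :
    cubicSum q e k l = cubicSum q e' (k - 3) (l + 3) := by
  unfold cubicSum
  rw [← (Equiv.addRight (1 : ℤ)).tsum_eq]
  refine tsum_congr fun j => ?_
  simp only [Equiv.coe_addRight, h]
  congr 3 <;> ring_nf

theorem one_sub_zpow_mul_cubicSum {q : ℂ} (hq0 : q ≠ 0) (hq : ‖q‖ < 1) (e e' : ℤ → ℤ) (k l : ℤ)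
    (h : ∀ j, e j + (l + 3 * j) = e' j) :
    (1 - q ^ (k + l)) * cubicSum q e k l =
      cubicSum q e k (l - 1) + cubicSum q e' (k - 1) l := by
  unfold cubicSum
  rw [← tsum_mul_left, ← (summable_mul_invQFact hq0 _ _ _).tsum_add
    (summable_mul_invQFact hq0 _ _ _)]
  refine tsum_congr fun j => ?_
  have := one_sub_zpow_mul_invQFact_mul hq0 hq (k - 3 * j) (l + 3 * j)
  rw [show k - 3 * j + (l + 3 * j) = k + l by ring,
    show l + 3 * j - 1 = l - 1 + 3 * j by ring, show k - 3 * j - 1 = k - 1 - 3 * j by ring] at this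
  rw [mul_left_comm, this, ← h j, zpow_add₀ hq0 (e j)]
  ring

theorem one_sub_zpow_mul_cubicSum' {q : ℂ} (hq0 : q ≠ 0) (hq : ‖q‖ < 1) (e e' : ℤ → ℤ) (k l : ℤ)
    (h : ∀ j, e j + (k - 3 * j) = e' j) :
    (1 - q ^ (k + l)) * cubicSum q e k l =
      cubicSum q e' k (l - 1) + cubicSum q e (k - 1) l := by
  unfold cubicSum
  rw [← tsum_mul_left, ← (summable_mul_invQFact hq0 _ _ _).tsum_add
    (summable_mul_invQFact hq0 _ _ _)]
  refine tsum_congr fun j => ?_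
  have := one_sub_zpow_mul_invQFact_mul' hq0 hq (k - 3 * j) (l + 3 * j)
  rw [show k - 3 * j + (l + 3 * j) = k + l by ring,
    show l + 3 * j - 1 = l - 1 + 3 * j by ring, show k - 3 * j - 1 = k - 1 - 3 * j by ring] at this
  rw [mul_left_comm, this, ← h j, zpow_add₀ hq0 (e j)]
  ring

theorem cubicSum_add_const {q : ℂ} (hq0 : q ≠ 0) (e e' : ℤ → ℤ) (n k l : ℤ)
    (h : ∀ j, e j = n + e' j) : cubicSum q e k l = q ^ n * cubicSum q e' k l := by
  unfold cubicSum
  rw [← tsum_mul_left]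
  refine tsum_congr fun j => ?_
  rw [h, zpow_add₀ hq0, mul_assoc]

theorem one_sub_zpow_ne_zero {q : ℂ} (hq : ‖q‖ < 1) (n : ℕ) (m : ℤ)
    (h : m = n + 1) : 1 - q ^ m ≠ 0 := by
  have := one_sub_mul_pow_ne_zero hq n
  rw [← pow_succ'] at this
  rw [h]
  exact_mod_cast this

/-! ### The two Bailey pairs. -/

section FiniteIdentities

variable {q : ℂ}

/-- Pascal splits each sum in two. The parts without the factor `q^n` are exchanged by `j ↦ -j` and
cancel. -/
theorem even_step (hq0 : q ≠ 0) (hq : ‖q‖ < 1) (n : ℤ) :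
    (1 - q ^ (2 * n)) * (cubicSum q (fun j => 3 * j ^ 2 - j) n n -
        cubicSum q (fun j => 3 * j ^ 2 + j) (n - 1) (n + 1)) =
      q ^ n * (cubicSum q (fun j => 3 * j ^ 2 - 2 * j) n (n - 1) -
        cubicSum q (fun j => 3 * j ^ 2 + 4 * j + 1) (n - 2) (n + 1)) := by
  have h1 := one_sub_zpow_mul_cubicSum hq0 hq (fun j => 3 * j ^ 2 - j)
    (fun j => n + (3 * j ^ 2 + 2 * j)) n n (fun j => by ring)
  have h2 := one_sub_zpow_mul_cubicSum hq0 hq (fun j => 3 * j ^ 2 + j)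
    (fun j => n + (3 * j ^ 2 + 4 * j + 1)) (n - 1) (n + 1) (fun j => by ring)
  rw [cubicSum_add_const hq0 _ _ n _ _ fun _ => rfl] at h1 h2
  rw [cubicSum_neg q (fun j => 3 * j ^ 2 + 2 * j) (fun j => 3 * j ^ 2 - 2 * j) _ _
    (fun j => by ring)] at h1
  rw [cubicSum_neg q (fun j => 3 * j ^ 2 + j) (fun j => 3 * j ^ 2 - j) _ (n + 1 - 1)
    (fun j => by ring)] at h2
  rw [show n + n = 2 * n by ring] at h1
  rw [show n - 1 + (n + 1) = 2 * n by ring, show n + 1 - 1 = n by ring,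
    show n - 1 - 1 = n - 2 by ring] at h2
  rw [mul_sub, h1, h2]
  ring

/-- The two sums are split by opposite forms of the Pascal rule, so that the parts without `q^n`
agree after `j ↦ j + 1` and cancel. -/
theorem odd_step (hq0 : q ≠ 0) (hq : ‖q‖ < 1) (n : ℤ) :
    (1 - q ^ (2 * n + 1)) * (cubicSum q (fun j => 3 * j ^ 2 - 2 * j) (n + 1) n -
        cubicSum q (fun j => 3 * j ^ 2 + 4 * j + 1) (n - 1) (n + 2)) =
      q ^ n * (cubicSum q (fun j => 3 * j ^ 2 - j) n n -
        cubicSum q (fun j => 3 * j ^ 2 + j) (n - 1) (n + 1)) := by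
  have h1 := one_sub_zpow_mul_cubicSum hq0 hq (fun j => 3 * j ^ 2 - 2 * j)
    (fun j => n + (3 * j ^ 2 + j)) (n + 1) n (fun j => by ring)
  have h2 := one_sub_zpow_mul_cubicSum' hq0 hq (fun j => 3 * j ^ 2 + 4 * j + 1)
    (fun j => n + (3 * j ^ 2 + j)) (n - 1) (n + 2) (fun j => by ring)
  rw [cubicSum_add_const hq0 _ _ n _ _ fun _ => rfl] at h1 h2
  rw [cubicSum_neg q (fun j => 3 * j ^ 2 + j) (fun j => 3 * j ^ 2 - j) _ _
    (fun j => by ring), cubicSum_add_one q (fun j => 3 * j ^ 2 - 2 * j)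
    (fun j => 3 * j ^ 2 + 4 * j + 1) _ (n - 1) (fun j => by ring)] at h1
  rw [show n + 1 + n = 2 * n + 1 by ring, show n + 1 - 3 = n - 1 - 1 by ring,
    show n - 1 + 3 = n + 2 by ring, show n + 1 - 1 = n by ring] at h1
  rw [show n - 1 + (n + 2) = 2 * n + 1 by ring, show n + 2 - 1 = n + 1 by ring] at h2
  rw [mul_sub, h1, h2]
  ring

/-- Here the parts carrying `q^n` cancel. The right side is that of `even_step` without its factor
`q^n`, which links the two Bailey pairs. -/
theorem even_step' (hq0 : q ≠ 0) (hq : ‖q‖ < 1) (n : ℤ) :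
    (1 - q ^ (2 * n)) * (cubicSum q (fun j => 3 * j ^ 2 - 2 * j) n n -
        cubicSum q (fun j => 3 * j ^ 2 + 2 * j) (n - 2) (n + 2)) =
      cubicSum q (fun j => 3 * j ^ 2 - 2 * j) n (n - 1) -
        cubicSum q (fun j => 3 * j ^ 2 + 4 * j + 1) (n - 2) (n + 1) := by
  have h1 := one_sub_zpow_mul_cubicSum hq0 hq (fun j => 3 * j ^ 2 - 2 * j)
    (fun j => n + (3 * j ^ 2 + j)) n n (fun j => by ring)
  have h2 := one_sub_zpow_mul_cubicSum' hq0 hq (fun j => 3 * j ^ 2 + 4 * j + 1)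
    (fun j => n + (3 * j ^ 2 + j)) (n - 1) (n + 1) (fun j => by ring)
  rw [cubicSum_neg q (fun j => 3 * j ^ 2 + 2 * j) (fun j => 3 * j ^ 2 - 2 * j) _ _
    (fun j => by ring), cubicSum_add_one q (fun j => 3 * j ^ 2 - 2 * j)
    (fun j => 3 * j ^ 2 + 4 * j + 1) (n + 2) _ (fun j => by ring),
    show n + 2 - 3 = n - 1 by ring, show n - 2 + 3 = n + 1 by ring]
  rw [show n + n = 2 * n by ring] at h1
  rw [show n - 1 + (n + 1) = 2 * n by ring, show n + 1 - 1 = n by ring,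
    show n - 1 - 1 = n - 2 by ring] at h2
  rw [mul_sub, h1, h2]
  ring

theorem cubicSum_zero (hq0 : q ≠ 0) (e : ℤ → ℤ) (he : e 0 = 0) : cubicSum q e 0 0 = 1 := by
  unfold cubicSum
  rw [tsum_eq_single 0]
  · simp [he, invQFact_zero]
  · intro j hj
    rcases lt_or_gt_of_ne hj with h | h
    · rw [invQFact_of_neg hq0 (n := 0 + 3 * j) (by omega)]; simp
    · rw [invQFact_of_neg hq0 (n := 0 - 3 * j) (by omega)]; simp

theorem cubicSum_eq_zero (hq0 : q ≠ 0) (e : ℤ → ℤ) (k l : ℤ)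
    (h : ∀ j, k - 3 * j < 0 ∨ l + 3 * j < 0) : cubicSum q e k l = 0 := by
  unfold cubicSum
  refine (tsum_congr fun j => ?_).trans tsum_zero
  rcases h j with h | h <;> rw [invQFact_of_neg hq0 h] <;> simp

theorem cubicSum_sub_cubicSum_even (hq0 : q ≠ 0) (hq : ‖q‖ < 1) (n : ℕ) :
    cubicSum q (fun j => 3 * j ^ 2 - j) n n - cubicSum q (fun j => 3 * j ^ 2 + j) (n - 1) (n + 1) =
      q ^ (n ^ 2) * invQFact q (2 * n) := by
  induction n with
  | zero =>
    simp only [Nat.cast_zero]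
    rw [cubicSum_zero hq0 _ (by norm_num), cubicSum_eq_zero hq0 _ _ _ (fun j => by omega)]
    simp [invQFact_zero]
  | succ n ih =>
    -- Passing from `2n` to `2n + 2` through the odd index `2n + 1` contributes `q^{n+1} * q^n =
    -- q^{(n+1)² - n²}`.
    have h1 := even_step hq0 hq ((n + 1 : ℕ) : ℤ)
    have h2 := odd_step hq0 hq (n : ℤ)
    rw [ih] at h2
    have d1 := invQFact_sub_one hq0 hq (2 * ((n + 1 : ℕ) : ℤ))
    have d2 := invQFact_sub_one hq0 hq (2 * (n : ℤ) + 1)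
    have n1 := one_sub_zpow_ne_zero hq (2 * n + 1) (2 * ((n + 1 : ℕ) : ℤ)) (by push_cast; ring)
    have n2 := one_sub_zpow_ne_zero hq (2 * n) (2 * (n : ℤ) + 1) (by push_cast; ring)
    rw [show 2 * ((n + 1 : ℕ) : ℤ) - 1 = 2 * n + 1 by push_cast; ring] at d1
    rw [show 2 * (n : ℤ) + 1 - 1 = 2 * n by ring] at d2
    rw [show ((n + 1 : ℕ) : ℤ) - 1 = n by push_cast; ring,
      show ((n + 1 : ℕ) : ℤ) - 2 = n - 1 by push_cast; ring,
      show ((n + 1 : ℕ) : ℤ) + 1 = n + 2 by push_cast; ring] at h1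
    rw [show ((n + 1 : ℕ) : ℤ) - 1 = n by push_cast; ring,
      show ((n + 1 : ℕ) : ℤ) + 1 = n + 2 by push_cast; ring]
    rw [show (n : ℤ) + 1 = ((n + 1 : ℕ) : ℤ) by push_cast; ring] at h2
    apply mul_left_cancel₀ n1
    apply mul_left_cancel₀ n2
    rw [h1, mul_left_comm, h2, d2, mul_left_comm (1 - q ^ (2 * ((n + 1 : ℕ) : ℤ))), ← d1]
    simp only [zpow_natCast]
    ring

theorem cubicSum_sub_cubicSum_odd (hq0 : q ≠ 0) (hq : ‖q‖ < 1) (n : ℕ) :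
    cubicSum q (fun j => 3 * j ^ 2 - 2 * j) n n -
        cubicSum q (fun j => 3 * j ^ 2 + 2 * j) (n - 2) (n + 2) =
      q ^ ((n : ℤ) ^ 2 - n) * invQFact q (2 * n) := by
  rcases n with _ | n
  · simp only [Nat.cast_zero]
    rw [cubicSum_zero hq0 _ (by norm_num), cubicSum_eq_zero hq0 _ _ _ (fun j => by omega)]
    simp [invQFact_zero]
  · have h1 := even_step hq0 hq ((n + 1 : ℕ) : ℤ)
    have h2 := even_step' hq0 hq ((n + 1 : ℕ) : ℤ)
    rw [← h2, cubicSum_sub_cubicSum_even hq0 hq] at h1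
    have n1 := one_sub_zpow_ne_zero hq (2 * n + 1) (2 * ((n + 1 : ℕ) : ℤ)) (by push_cast; ring)
    apply mul_left_cancel₀ n1
    apply mul_left_cancel₀ (zpow_ne_zero ((n + 1 : ℕ) : ℤ) hq0)
    rw [← h1, zpow_sub₀ hq0]
    have : q ^ (((n + 1 : ℕ) : ℤ)) ≠ 0 := zpow_ne_zero _ hq0
    rw [show (((n + 1 : ℕ) : ℤ)) ^ 2 = (((n + 1) ^ 2 : ℕ) : ℤ) by push_cast; ring,
      zpow_natCast q ((n + 1) ^ 2)]
    field_simp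

end FiniteIdentities

/-! ### The `q`-Pfaff–Saalschütz sum. -/

/-- The `q`-Pfaff–Saalschütz sum, in convolution form. -/
theorem qPfaffSaalschutz {q : ℂ} (hq0 : q ≠ 0) (hq : ‖q‖ < 1) {X Y c t : ℂ} (hX : X ≠ 0)
    (hY : Y ≠ 0) (ht : t = c / (X * Y)) (hc : ∀ k : ℕ, 1 - c * q ^ k ≠ 0) (M : ℕ) :
    ∑ j ∈ Finset.range (M + 1), qPoch X q j * qPoch Y q j * qPoch t q ((M - j : ℕ) : ℤ) * t ^ j /
        (qPoch q q j * qPoch q q ((M - j : ℕ) : ℤ) * qPoch c q j) =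
      qPoch (c / X) q M * qPoch (c / Y) q M / (qPoch q q M * qPoch c q M) := by
  have hf := qPoch_natCast_ne_zero (one_sub_mul_pow_ne_zero hq)
  have hf1 := one_sub_mul_pow_ne_zero hq
  have hcf := qPoch_natCast_ne_zero hc
  induction M with
  | zero => simp [qPoch_zero]
  | succ M ih =>
    -- Telescoping certificate for the recurrence in `M` that the closed form satisfies. The factor
    -- `1 - q^m` kills the boundary term at `m = 0`.
    have key : ∀ m ≤ M + 1, ∑ j ∈ Finset.range m,
        ((1 - q * q ^ M) * (1 - c * q ^ M) *
          (qPoch X q j * qPoch Y q j * qPoch t q ((M + 1 - j : ℕ) : ℤ) * t ^ j /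
            (qPoch q q j * qPoch q q ((M + 1 - j : ℕ) : ℤ) * qPoch c q j)) -
          (1 - c / X * q ^ M) * (1 - c / Y * q ^ M) *
          (qPoch X q j * qPoch Y q j * qPoch t q ((M - j : ℕ) : ℤ) * t ^ j /
            (qPoch q q j * qPoch q q ((M - j : ℕ) : ℤ) * qPoch c q j))) =
        -(qPoch X q m * qPoch Y q m * qPoch t q ((M + 1 - m : ℕ) : ℤ) * t ^ m * q ^ (M + 1 - m) *
          (1 - q ^ m) * (1 - c * q ^ m / q) /
            (qPoch q q m * qPoch q q ((M + 1 - m : ℕ) : ℤ) * qPoch c q m)) := by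
      intro m hm
      induction m with
      | zero => simp
      | succ m ihm =>
        obtain ⟨l, rfl⟩ : ∃ l, M = m + l := ⟨M - m, by omega⟩
        rw [Finset.sum_range_succ, ihm (by omega), show m + l + 1 - m = l + 1 by omega,
          show m + l - m = l by omega, show m + l + 1 - (m + 1) = l by omega]
        simp only [qPoch_natCast_succ, ht]
        have a1 := hf m
        have a2 := hf l
        have a3 := hcf m
        have a4 := hf1 m
        have a5 := hf1 l
        have a6 := hc m
        generalize qPoch q q m = u1 at *
        generalize qPoch q q l = u2 at *
        generalize qPoch c q m = u3 at *
        generalize qPoch X q m = u4 at *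
        generalize qPoch Y q m = u5 at *
        generalize qPoch (c / (X * Y)) q l = u6 at *
        simp only [pow_succ, pow_add] at *
        generalize q ^ m = Q at *
        generalize q ^ l = R at *
        have b4 : 1 - Q * q ≠ 0 := by rwa [mul_comm]
        have b5 : 1 - R * q ≠ 0 := by rwa [mul_comm]
        have b6 : 1 - Q * c ≠ 0 := by rwa [mul_comm]
        field_simp
        ring
    have k1 := key (M + 1) le_rfl
    rw [Finset.sum_sub_distrib, ← Finset.mul_sum, ← Finset.mul_sum, ih] at k1
    -- The term `j = M + 1` of the longer sum has no partner in the shorter one; it cancels the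
    -- boundary term of `key` at `m = M + 1`.
    rw [Finset.sum_range_succ]
    have n1 := hf1 M
    have n2 := hc M
    apply mul_left_cancel₀ (mul_ne_zero n1 n2)
    rw [mul_add, sub_eq_iff_eq_add.mp k1]
    simp only [Nat.sub_self, Nat.cast_zero, qPoch_zero, qPoch_natCast_succ]
    have a1 := hf M
    have a3 := hcf M
    generalize qPoch q q M = u1 at *
    generalize qPoch c q M = u3 at *
    generalize qPoch X q M = u4 at *
    generalize qPoch Y q M = u5 at *
    generalize qPoch (c / X) q M = u6 at *
    generalize qPoch (c / Y) q M = u7 at *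
    simp only [pow_succ] at *
    generalize q ^ M = Q at *
    have b1 : 1 - Q * q ≠ 0 := by rwa [mul_comm]
    have b2 : 1 - Q * c ≠ 0 := by rwa [mul_comm]
    field_simp
    ring

/-! ### Finite form of Bailey's lemma. -/

theorem one_sub_div_mul_pow_ne_zero {q x : ℂ} (hx0 : x ≠ 0) (hx : ∀ k : ℕ, x ≠ q ^ (k + 1))
    (k : ℕ) : 1 - q / x * q ^ k ≠ 0 := by
  intro h
  apply hx k
  field_simp at h
  rw [mul_zero] at h
  rw [pow_succ']
  exact sub_eq_zero.mp h

theorem qPoch_natCast_add (a q : ℂ) (m n : ℕ) :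
    qPoch a q ((m + n : ℕ) : ℤ) = qPoch a q (m : ℤ) * qPoch (a * q ^ m) q (n : ℤ) := by
  simp only [qPoch_natCast, Finset.prod_range_add, pow_add, mul_assoc]

/-- Reflection of `(x; q)_m / (q/x; q)_m` at `m = 0`. -/
theorem qPoch_neg_div_qPoch_neg {q x : ℂ} (hq0 : q ≠ 0) (hx0 : x ≠ 0)
    (hx : ∀ k : ℕ, x ≠ q ^ (k + 1)) (r : ℕ) :
    qPoch x q (-(r : ℤ)) / qPoch (q / x) q (-(r : ℤ)) =
      qPoch x q r / qPoch (q / x) q r * (q / x ^ 2) ^ r := by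
  rcases r with _ | r
  · simp [qPoch_zero]
  · have e : ∀ a : ℂ, qPoch a q (-((r + 1 : ℕ) : ℤ)) =
        (∏ k ∈ Finset.range (r + 1), (1 - a * q ^ (-((k : ℤ) + 1))))⁻¹ := fun a => rfl
    -- `inv_div_inv` needs no nonvanishing. If `x = q^{-k}`, a pole of `(q/x;q)_{-r}` is read as
    -- `0`, as is the quotient by it, and for the same `r` the factor `(x;q)_r` on the right
    -- vanishes.
    rw [e, e, qPoch_natCast, qPoch_natCast, inv_div_inv, ← Finset.prod_div_distrib,
      ← Finset.prod_div_distrib, Finset.pow_eq_prod_const, ← Finset.prod_mul_distrib]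
    refine Finset.prod_congr rfl fun k _ => ?_
    have h1 := one_sub_div_mul_pow_ne_zero hx0 hx k
    have h2 : q ^ (-((k : ℤ) + 1)) = (q ^ k * q)⁻¹ := by
      rw [zpow_neg, zpow_add₀ hq0, zpow_natCast, zpow_one]
    have h3 : q ^ k ≠ 0 := pow_ne_zero _ hq0
    rw [h2]
    generalize q ^ k = Q at *
    have h4 : x - q * Q ≠ 0 := by
      intro h
      apply h1
      field_simp
      rwa [mul_zero]
    have h5 : q * Q - x ≠ 0 := by
      rw [← neg_sub]
      exact neg_ne_zero.mpr h4
    have e1 : 1 - x * (Q * q)⁻¹ = (q * Q - x) / (q * Q) := by field_simp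
    have e2 : 1 - q / x * (Q * q)⁻¹ = (x * Q - 1) / (x * Q) := by field_simp
    have e3 : 1 - q / x * Q = -(q * Q - x) / x := by field_simp; ring
    rw [e1, e2, e3]
    field_simp
    ring

/-- The reflection factors `q/x²` and `q/y²` combine with the inverted power of `1/(xy)` to leave
`q^{2r}`. Hence `coeff q x y r * q ^ r` is even in `r`. -/
theorem coeff_neg {q x y : ℂ} (hq0 : q ≠ 0) (hx0 : x ≠ 0) (hy0 : y ≠ 0)
    (hx : ∀ k : ℕ, x ≠ q ^ (k + 1)) (hy : ∀ k : ℕ, y ≠ q ^ (k + 1)) (r : ℕ) :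
    coeff q x y (-(r : ℤ)) = coeff q x y r * q ^ (2 * r) := by
  unfold coeff
  rw [mul_div_mul_comm, mul_div_mul_comm, qPoch_neg_div_qPoch_neg hq0 hx0 hx,
    qPoch_neg_div_qPoch_neg hq0 hy0 hy, zpow_neg, zpow_natCast]
  simp only [one_div, inv_pow, inv_inv, div_pow, mul_pow]
  field_simp
  ring

/-- The `q`-Pfaff–Saalschütz sum as it enters Bailey's lemma. -/
theorem sum_mul_invQFact_mul {q x y : ℂ} (hq0 : q ≠ 0) (hq : ‖q‖ < 1) (hx0 : x ≠ 0) (hy0 : y ≠ 0)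
    (hx : ∀ k : ℕ, x ≠ q ^ (k + 1)) (hy : ∀ k : ℕ, y ≠ q ^ (k + 1)) (N : ℕ) (r : ℤ) :
    ∑ n ∈ Finset.range (N + 1), qPoch x q n * qPoch y q n * (q / (x * y)) ^ n *
        (qPoch (q / (x * y)) q ((N - n : ℕ) : ℤ) * invQFact q ((N : ℤ) - n)) *
        (invQFact q (n - r) * invQFact q (n + r)) =
      qPoch (q / x) q N * qPoch (q / y) q N *
        (coeff q x y r * q ^ r * (invQFact q (N - r) * invQFact q (N + r))) := by
  have main : ∀ r : ℕ, ∑ n ∈ Finset.range (N + 1), qPoch x q n * qPoch y q n *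
        (q / (x * y)) ^ n *
        (qPoch (q / (x * y)) q ((N - n : ℕ) : ℤ) * invQFact q ((N : ℤ) - n)) *
        (invQFact q ((n : ℤ) - r) * invQFact q (n + r)) =
      qPoch (q / x) q N * qPoch (q / y) q N *
        (coeff q x y r * q ^ (r : ℤ) * (invQFact q ((N : ℤ) - r) * invQFact q (N + r))) := by
    intro r
    rcases lt_or_ge N r with h | h
    · rw [invQFact_of_neg hq0 (n := (N : ℤ) - r) (by omega)]
      simp only [zero_mul, mul_zero]
      refine Finset.sum_eq_zero fun n hn => ?_
      have := Finset.mem_range.mp hn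
      rw [invQFact_of_neg hq0 (n := (n : ℤ) - r) (by omega)]
      simp
    · obtain ⟨M, rfl⟩ := Nat.exists_eq_add_of_le h
      have hc : ∀ k : ℕ, 1 - q * q ^ (2 * r) * q ^ k ≠ 0 := fun k => by
        have := one_sub_mul_pow_ne_zero hq (2 * r + k)
        rwa [pow_add, ← mul_assoc] at this
      have hqr : q ^ r ≠ 0 := pow_ne_zero _ hq0
      -- Terms with `n < r` vanish. After `n = r + j`, splitting `(a;q)_{r+j} = (a;q)_r (a q^r;q)_j`
      -- leaves a sum with these parameters, since `(q;q)_{2r+j}` contributes `c = q^{2r+1}`.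
      have hs := qPfaffSaalschutz hq0 hq (X := x * q ^ r) (Y := y * q ^ r)
        (c := q * q ^ (2 * r)) (t := q / (x * y)) (mul_ne_zero hx0 hqr) (mul_ne_zero hy0 hqr)
        (by rw [pow_mul']; field_simp) hc M
      have eX : q * q ^ (2 * r) / (x * q ^ r) = q / x * q ^ r := by rw [pow_mul']; field_simp
      have eY : q * q ^ (2 * r) / (y * q ^ r) = q / y * q ^ r := by rw [pow_mul']; field_simp
      rw [eX, eY] at hs
      have hx1 := qPoch_natCast_ne_zero (one_sub_div_mul_pow_ne_zero hx0 hx) r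
      have hy1 := qPoch_natCast_ne_zero (one_sub_div_mul_pow_ne_zero hy0 hy) r
      rw [add_assoc, Finset.sum_range_add, Finset.sum_eq_zero, zero_add]
      · have e1 : ((r + M : ℕ) : ℤ) - r = (M : ℤ) := by push_cast; ring
        have e2 : ((r + M : ℕ) : ℤ) + r = ((2 * r + M : ℕ) : ℤ) := by push_cast; ring
        rw [e1, e2]
        simp only [coeff, invQFact, qPoch_natCast_add, zpow_natCast]
        trans (qPoch x q r * qPoch y q r * (q / (x * y)) ^ r * (qPoch q q ((2 * r : ℕ) : ℤ))⁻¹) *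
          (qPoch (q / x * q ^ r) q M * qPoch (q / y * q ^ r) q M /
            (qPoch q q M * qPoch (q * q ^ (2 * r)) q M))
        · rw [← hs, Finset.mul_sum]
          refine Finset.sum_congr rfl fun j hj => ?_
          have hj' := Finset.mem_range.mp hj
          have f1 : r + M - (r + j) = M - j := by omega
          have f2 : ((r + M : ℕ) : ℤ) - ((r + j : ℕ) : ℤ) = ((M - j : ℕ) : ℤ) := by omega
          have f3 : ((r + j : ℕ) : ℤ) - r = (j : ℤ) := by push_cast; ring
          have f4 : ((r + j : ℕ) : ℤ) + r = ((2 * r + j : ℕ) : ℤ) := by push_cast; ring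
          rw [f1, f2, f3, f4, qPoch_natCast_add q q (2 * r) j, pow_add]
          simp only [div_eq_mul_inv, mul_inv]
          ring
        · generalize qPoch (q / x) q r = u at *
          generalize qPoch (q / y) q r = v at *
          simp only [div_eq_mul_inv, mul_inv, mul_pow, one_mul, inv_pow]
          field_simp
      · intro n hn
        have := Finset.mem_range.mp hn
        rw [invQFact_of_neg hq0 (n := (n : ℤ) - r) (by omega)]
        simp
  obtain ⟨s, rfl | rfl⟩ := Int.eq_nat_or_neg r
  · exact main s
  · have h := main s
    rw [coeff_neg hq0 hx0 hy0 hx hy]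
    have e : q ^ (2 * s) * q ^ (-(s : ℤ)) = q ^ (s : ℤ) := by
      rw [← zpow_natCast, ← zpow_add₀ hq0]
      congr 1
      push_cast
      ring
    rw [mul_assoc (coeff q x y s), e]
    simp only [sub_neg_eq_add, ← sub_eq_add_neg, mul_comm (invQFact q (_ + (s : ℤ)))]
    exact h

/-- Bailey's lemma, in a finite form, for a sequence supported on the class of `s` mod `3`. -/
theorem sum_mul_cubicSum {q x y : ℂ} (hq0 : q ≠ 0) (hq : ‖q‖ < 1) (hx0 : x ≠ 0) (hy0 : y ≠ 0)
    (hx : ∀ k : ℕ, x ≠ q ^ (k + 1)) (hy : ∀ k : ℕ, y ≠ q ^ (k + 1)) (e : ℤ → ℤ) (s : ℤ) (N : ℕ) :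
    ∑ n ∈ Finset.range (N + 1), qPoch x q n * qPoch y q n * (q / (x * y)) ^ n *
        (qPoch (q / (x * y)) q ((N - n : ℕ) : ℤ) * invQFact q ((N : ℤ) - n)) *
        cubicSum q e (n - s) (n + s) =
      qPoch (q / x) q N * qPoch (q / y) q N *
        ∑' j : ℤ, coeff q x y (3 * j + s) * q ^ (3 * j + s + e j) *
          (invQFact q (N - (3 * j + s)) * invQFact q (N + (3 * j + s))) := by
  unfold cubicSum
  simp only [← tsum_mul_left]
  rw [← Summable.tsum_finsetSum]
  · refine tsum_congr fun j => ?_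
    have h := congrArg (fun z => q ^ e j * z)
      (sum_mul_invQFact_mul hq0 hq hx0 hy0 hx hy N (3 * j + s))
    simp only [Finset.mul_sum] at h
    rw [zpow_add₀ hq0 (3 * j + s)]
    convert h using 1
    · refine Finset.sum_congr rfl fun n _ => ?_
      rw [show (n : ℤ) - s - 3 * j = n - (3 * j + s) by ring,
        show (n : ℤ) + s + 3 * j = n + (3 * j + s) by ring]
      ring
    · ring
  · intro n _
    exact (summable_mul_invQFact hq0 _ _ _).mul_left _

open Filter Topology

/-! ### Passage to the limit. -/

theorem tendsto_qPoch (a : ℂ) {q : ℂ} (hq : ‖q‖ < 1) :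
    Tendsto (fun n : ℕ => qPoch a q n) atTop (𝓝 (qPochInf a q)) :=
  (multipliable_qPochInf a hq).tendsto_prod_tprod_nat

theorem qPochInf_ne_zero {a q : ℂ} (hq : ‖q‖ < 1) (h : ∀ k : ℕ, 1 - a * q ^ k ≠ 0) :
    qPochInf a q ≠ 0 := by
  have := tprod_one_add_ne_zero_of_summable (f := fun k : ℕ => -(a * q ^ k))
    (fun k => by simpa [sub_eq_add_neg] using h k) (by
      simpa [norm_mul, norm_pow] using
        (summable_geometric_of_lt_one (norm_nonneg q) hq).mul_left ‖a‖)
  simpa [qPochInf, sub_eq_add_neg] using this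

theorem exists_norm_le_of_tendsto {u : ℕ → ℂ} {l : ℂ} (h : Tendsto u atTop (𝓝 l)) :
    ∃ C, 0 ≤ C ∧ ∀ n, ‖u n‖ ≤ C := by
  obtain ⟨C, hC⟩ := (Metric.isBounded_range_of_tendsto u h).exists_norm_le
  exact ⟨C, (norm_nonneg _).trans (hC _ ⟨0, rfl⟩), fun n => hC _ ⟨n, rfl⟩⟩

theorem tendsto_invQFact {q : ℂ} (hq : ‖q‖ < 1) :
    Tendsto (invQFact q) atTop (𝓝 (qPochInf q q)⁻¹) := by
  rw [← Nat.map_cast_int_atTop, tendsto_map'_iff]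
  exact (tendsto_qPoch q hq).inv₀ (qPochInf_ne_zero hq (one_sub_mul_pow_ne_zero hq))

theorem exists_norm_invQFact_le {q : ℂ} (hq0 : q ≠ 0) (hq : ‖q‖ < 1) :
    ∃ C, 0 ≤ C ∧ ∀ n : ℤ, ‖invQFact q n‖ ≤ C := by
  obtain ⟨C, h0, hC⟩ := exists_norm_le_of_tendsto
    ((tendsto_invQFact hq).comp tendsto_natCast_atTop_atTop)
  refine ⟨C, h0, fun n => ?_⟩
  rcases lt_or_ge n 0 with h | h
  · simpa [invQFact_of_neg hq0 h] using h0
  · obtain ⟨m, rfl⟩ := Int.eq_ofNat_of_zero_le h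
    exact hC m

/-- Both reciprocal factorials tend to `1/(q;q)_∞` for each fixed `j` and are bounded uniformly in
`N` and `j`, so dominated convergence applies. -/
theorem tendsto_tsum_mul_invQFact {q : ℂ} (hq0 : q ≠ 0) (hq : ‖q‖ < 1) {f : ℤ → ℂ}
    (hf : Summable f) (ρ : ℤ → ℤ) :
    Tendsto (fun N : ℕ => ∑' j, f j * (invQFact q (N - ρ j) * invQFact q (N + ρ j))) atTop
      (𝓝 ((∑' j, f j) * ((qPochInf q q)⁻¹ * (qPochInf q q)⁻¹))) := by
  obtain ⟨C, h0, hC⟩ := exists_norm_invQFact_le hq0 hq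
  rw [← tsum_mul_right]
  refine tendsto_tsum_of_dominated_convergence (hf.norm.mul_right (C * C)) (fun j => ?_)
    (Eventually.of_forall fun N j => ?_)
  · refine Tendsto.const_mul _ (Tendsto.mul ?_ ?_)
    · exact (tendsto_invQFact hq).comp
        (tendsto_atTop_add_const_right _ (-ρ j) tendsto_natCast_atTop_atTop)
    · exact (tendsto_invQFact hq).comp
        (tendsto_atTop_add_const_right _ (ρ j) tendsto_natCast_atTop_atTop)
  · rw [norm_mul, norm_mul]
    gcongr <;> exact hC _

theorem tendsto_sum_mul_qPoch_mul_invQFact {q : ℂ} (hq0 : q ≠ 0) (hq : ‖q‖ < 1) (t : ℂ)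
    {w : ℕ → ℂ} (hw : Summable w) :
    Tendsto (fun N : ℕ => ∑ n ∈ Finset.range (N + 1),
        w n * (qPoch t q ((N - n : ℕ) : ℤ) * invQFact q ((N : ℤ) - n))) atTop
      (𝓝 ((∑' n, w n) * (qPochInf t q * (qPochInf q q)⁻¹))) := by
  obtain ⟨C, h0, hC⟩ := exists_norm_invQFact_le hq0 hq
  obtain ⟨C', h0', hC'⟩ := exists_norm_le_of_tendsto (tendsto_qPoch t hq)
  have h : ∀ N : ℕ, ∑ n ∈ Finset.range (N + 1),
        w n * (qPoch t q ((N - n : ℕ) : ℤ) * invQFact q ((N : ℤ) - n)) =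
      ∑' n : ℕ, w n * (qPoch t q ((N - n : ℕ) : ℤ) * invQFact q ((N : ℤ) - n)) := fun N => by
    refine (tsum_eq_sum fun n hn => ?_).symm
    rw [Finset.mem_range] at hn
    -- For `n > N` the truncated `N - n` is `0`, so only the integer argument of `invQFact` cuts the
    -- series off.
    rw [invQFact_of_neg hq0 (by omega)]
    simp
  simp only [h]
  rw [← tsum_mul_right]
  refine tendsto_tsum_of_dominated_convergence (hw.norm.mul_right (C' * C)) (fun j => ?_)
    (Eventually.of_forall fun N j => ?_)
  · refine Tendsto.const_mul _ (Tendsto.mul ?_ ?_)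
    · exact (tendsto_qPoch t hq).comp (tendsto_sub_atTop_nat j)
    · exact (tendsto_invQFact hq).comp
        (tendsto_atTop_add_const_right _ (-(j : ℤ)) tendsto_natCast_atTop_atTop)
  · rw [norm_mul, norm_mul]
    gcongr
    · exact hC' _
    · exact hC _

/-! ### Absolute convergence. -/

theorem summable_pow_mul_pow_sq (A : ℝ) {ρ : ℝ} (hρ0 : 0 ≤ ρ) (hρ : ρ < 1) :
    Summable fun n : ℕ => A ^ n * ρ ^ (n ^ 2) := by
  have h : Tendsto (fun n : ℕ => A * ρ ^ n) atTop (𝓝 0) := by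
    simpa using (tendsto_pow_atTop_nhds_zero_of_lt_one hρ0 hρ).const_mul A
  refine (summable_geometric_of_lt_one (r := 1 / 2) (by norm_num)
    (by norm_num)).of_norm_bounded_eventually_nat ?_
  filter_upwards [h.norm.eventually_le_const (u := 1 / 2) (by norm_num)] with n hn
  rw [sq, pow_mul, ← mul_pow, norm_pow]
  exact pow_le_pow_left₀ (norm_nonneg _) hn n

/-- For `m ≥ 0` the quotient of `q`-factorials converges, hence is bounded, and only the power of
`1/(xy)` can grow. Negative `m` reduces to this by `coeff_neg`, as `‖q^{2r}‖ ≤ 1`. -/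
theorem exists_norm_coeff_le {q x y : ℂ} (hq0 : q ≠ 0) (hq : ‖q‖ < 1) (hx0 : x ≠ 0) (hy0 : y ≠ 0)
    (hx : ∀ k : ℕ, x ≠ q ^ (k + 1)) (hy : ∀ k : ℕ, y ≠ q ^ (k + 1)) :
    ∃ C B : ℝ, 0 ≤ C ∧ 1 ≤ B ∧ ∀ m : ℤ, ‖coeff q x y m‖ ≤ C * B ^ m.natAbs := by
  have hd := ((tendsto_qPoch x hq).mul (tendsto_qPoch y hq)).div
    ((tendsto_qPoch (q / x) hq).mul (tendsto_qPoch (q / y) hq))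
    (mul_ne_zero (qPochInf_ne_zero hq (one_sub_div_mul_pow_ne_zero hx0 hx))
      (qPochInf_ne_zero hq (one_sub_div_mul_pow_ne_zero hy0 hy)))
  obtain ⟨C, h0, hC⟩ := exists_norm_le_of_tendsto hd
  have hnat : ∀ m : ℕ, ‖coeff q x y m‖ ≤ C * max 1 ‖1 / (x * y)‖ ^ m := fun m => by
    rw [coeff, norm_mul, zpow_natCast, norm_pow]
    gcongr
    · exact hC m
    · exact le_max_right _ _
  refine ⟨C, max 1 ‖1 / (x * y)‖, h0, le_max_left _ _, fun m => ?_⟩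
  obtain ⟨s, rfl | rfl⟩ := Int.eq_nat_or_neg m
  · simpa using hnat s
  · rw [coeff_neg hq0 hx0 hy0 hx hy, norm_mul, Int.natAbs_neg, Int.natAbs_natCast, norm_pow]
    exact (mul_le_of_le_one_right (norm_nonneg _)
      (pow_le_one₀ (norm_nonneg _) hq.le)).trans (hnat s)

/-- Geometric growth of `coeff` loses to quadratic decay. The slack `-1` in `he` is needed for `T₁`
and `T₂`, whose exponents are `0` at `j = -1`. -/
theorem summable_coeff_mul {q x y : ℂ} (hq0 : q ≠ 0) (hq : ‖q‖ < 1) (hx0 : x ≠ 0) (hy0 : y ≠ 0)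
    (hx : ∀ k : ℕ, x ≠ q ^ (k + 1)) (hy : ∀ k : ℕ, y ≠ q ^ (k + 1)) (s : ℕ) (e : ℤ → ℤ)
    (he : ∀ j, j ^ 2 - 1 ≤ e j) :
    Summable fun j : ℤ => coeff q x y (3 * j + s) * q ^ e j := by
  obtain ⟨C, B, h0, h1, hC⟩ := exists_norm_coeff_le hq0 hq hx0 hy0 hx hy
  have hq0' : 0 < ‖q‖ := norm_pos_iff.mpr hq0
  have hb : ∀ j : ℤ, ‖coeff q x y (3 * j + s) * q ^ e j‖ ≤
      C * B ^ s * ‖q‖⁻¹ * ((B ^ 3) ^ j.natAbs * ‖q‖ ^ (j.natAbs ^ 2)) := fun j => by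
    have e1 : ‖coeff q x y (3 * j + s)‖ ≤ C * (B ^ s * (B ^ 3) ^ j.natAbs) := by
      refine (hC _).trans ?_
      rw [← pow_mul, ← pow_add]
      gcongr
      omega
    have e2 : ‖q‖ ^ e j ≤ ‖q‖⁻¹ * ‖q‖ ^ (j.natAbs ^ 2) := by
      refine (zpow_le_zpow_right_of_le_one₀ hq0' hq.le (he j)).trans_eq ?_
      rw [zpow_sub₀ hq0'.ne', ← Int.natAbs_sq j, ← zpow_natCast]
      push_cast
      rw [zpow_one]
      ring
    rw [norm_mul, norm_zpow]
    calc _ ≤ C * (B ^ s * (B ^ 3) ^ j.natAbs) * (‖q‖⁻¹ * ‖q‖ ^ (j.natAbs ^ 2)) := by gcongr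
      _ = _ := by ring
  refine Summable.of_norm_bounded (Summable.mul_left _ ?_) hb
  refine Summable.of_nat_of_neg ?_ ?_ <;>
    simpa using summable_pow_mul_pow_sq (B ^ 3) (norm_nonneg q) hq

theorem summable_lhsTerm {q x y : ℂ} (hq0 : q ≠ 0) (hq : ‖q‖ < 1) :
    Summable (lhsTerm q x y) := by
  obtain ⟨C, h0, hC⟩ := exists_norm_le_of_tendsto (tendsto_qPoch x hq)
  obtain ⟨C', h0', hC'⟩ := exists_norm_le_of_tendsto (tendsto_qPoch y hq)
  obtain ⟨K, h0K, hK⟩ := exists_norm_invQFact_le hq0 hq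
  refine Summable.of_norm_bounded ((summable_pow_mul_pow_sq ‖1 / (x * y)‖ (norm_nonneg q)
    hq).mul_left (C * C' * K * 2)) fun n => ?_
  have e : ‖q ^ n - 1‖ ≤ 2 := by
    refine (norm_sub_le _ _).trans ?_
    rw [norm_pow, norm_one]
    linarith [pow_le_one₀ (n := n) (norm_nonneg q) hq.le]
  rw [lhsTerm, div_eq_mul_inv, ← invQFact]
  simp only [norm_mul, norm_pow]
  calc _ ≤ C * C' * K * ‖1 / (x * y)‖ ^ n * 2 * ‖q‖ ^ (n ^ 2) := by
        gcongr
        · exact hC n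
        · exact hC' n
        · exact hK _
    _ = _ := by ring

end QBailey

/-! ### Assembly. -/

open QBailey in
theorem mainTheorem2 (q x y : ℂ) (hq0 : 0 < ‖q‖) (hq1 : ‖q‖ < 1)
    (hx0 : x ≠ 0) (hy0 : y ≠ 0)
    (hx : ∀ k : ℕ, x ≠ q ^ (k + 1)) (hy : ∀ k : ℕ, y ≠ q ^ (k + 1))
    (hxy : ∀ k : ℕ, x * y ≠ q ^ (k + 1)) :
    Summable (QBailey.lhsTerm q x y) ∧
    Summable (QBailey.S₁Term q x y) ∧ Summable (QBailey.S₂Term q x y) ∧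
    Summable (QBailey.T₁Term q x y) ∧ Summable (QBailey.T₂Term q x y) ∧
    ∑' n : ℕ, QBailey.lhsTerm q x y n =
      ((∑' n : ℤ, QBailey.S₁Term q x y n) - (∑' n : ℤ, QBailey.S₂Term q x y n)
        - (∑' n : ℤ, QBailey.T₁Term q x y n) + (∑' n : ℤ, QBailey.T₂Term q x y n))
      * ((QBailey.qPochInf (q / x) q * QBailey.qPochInf (q / y) q)
        / (QBailey.qPochInf q q * QBailey.qPochInf (q / (x * y)) q)) := by
  have hq : q ≠ 0 := norm_pos_iff.mp hq0
  have hl : Summable (lhsTerm q x y) := summable_lhsTerm hq hq1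
  have hS₁ : Summable (S₁Term q x y) :=
    (summable_coeff_mul hq hq1 hx0 hy0 hx hy 0 (fun j => 3 * j ^ 2 + 2 * j)
      fun j => by nlinarith).congr fun j => by simp [S₁Term]
  have hS₂ : Summable (S₂Term q x y) :=
    (summable_coeff_mul hq hq1 hx0 hy0 hx hy 0 (fun j => 3 * j ^ 2 + j)
      fun j => by nlinarith).congr fun j => by simp [S₂Term]
  have hT₁ : Summable (T₁Term q x y) :=
    summable_coeff_mul hq hq1 hx0 hy0 hx hy 1 (fun j => 3 * j ^ 2 + 4 * j + 1)
      fun j => by nlinarith [sq_nonneg (j + 1)]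
  have hT₂ : Summable (T₂Term q x y) := by
    refine summable_coeff_mul hq hq1 hx0 hy0 hx hy 2 (fun j => 3 * j ^ 2 + 5 * j + 2)
      (fun j => ?_)
    -- The difference is `(2j + 3)(j + 1)`, negative only strictly between `-3/2` and `-1`, where
    -- there is no integer.
    rcases le_or_gt j (-2) with h | h <;> nlinarith
  refine ⟨hl, hS₁, hS₂, hT₁, hT₂, ?_⟩
  have hfin : ∀ N : ℕ, ∑ n ∈ Finset.range (N + 1), lhsTerm q x y n *
        (qPoch (q / (x * y)) q ((N - n : ℕ) : ℤ) * invQFact q ((N : ℤ) - n)) =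
      qPoch (q / x) q N * qPoch (q / y) q N *
        ((∑' j, S₁Term q x y j * (invQFact q (N - 3 * j) * invQFact q (N + 3 * j))) -
        (∑' j, S₂Term q x y j * (invQFact q (N - 3 * j) * invQFact q (N + 3 * j))) -
        (∑' j, T₁Term q x y j * (invQFact q (N - (3 * j + 1)) * invQFact q (N + (3 * j + 1)))) +
        ∑' j, T₂Term q x y j *
          (invQFact q (N - (3 * j + 2)) * invQFact q (N + (3 * j + 2)))) := by
    intro N
    have s1 := sum_mul_cubicSum hq hq1 hx0 hy0 hx hy (fun j => 3 * j ^ 2 - j) 0 N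
    have s2 := sum_mul_cubicSum hq hq1 hx0 hy0 hx hy (fun j => 3 * j ^ 2 - 2 * j) 0 N
    have t1 := sum_mul_cubicSum hq hq1 hx0 hy0 hx hy (fun j => 3 * j ^ 2 + j) 1 N
    have t2 := sum_mul_cubicSum hq hq1 hx0 hy0 hx hy (fun j => 3 * j ^ 2 + 2 * j) 2 N
    simp only [add_zero, sub_zero] at s1 s2
    have es1 : ∀ j : ℤ, 3 * j + (3 * j ^ 2 - j) = 3 * j ^ 2 + 2 * j := fun j => by ring
    have es2 : ∀ j : ℤ, 3 * j + (3 * j ^ 2 - 2 * j) = 3 * j ^ 2 + j := fun j => by ring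
    have et1 : ∀ j : ℤ, 3 * j + 1 + (3 * j ^ 2 + j) = 3 * j ^ 2 + 4 * j + 1 := fun j => by ring
    have et2 : ∀ j : ℤ, 3 * j + 2 + (3 * j ^ 2 + 2 * j) = 3 * j ^ 2 + 5 * j + 2 :=
      fun j => by ring
    simp only [es1] at s1
    simp only [es2] at s2
    simp only [et1] at t1
    simp only [et2] at t2
    simp only [S₁Term, S₂Term, T₁Term, T₂Term]
    rw [mul_add, mul_sub, mul_sub, ← s1, ← s2, ← t1, ← t2, ← Finset.sum_sub_distrib,
      ← Finset.sum_sub_distrib, ← Finset.sum_add_distrib]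
    refine Finset.sum_congr rfl fun n _ => ?_
    have hE := cubicSum_sub_cubicSum_even hq hq1 n
    have hH := cubicSum_sub_cubicSum_odd hq hq1 n
    -- The two Bailey pairs turn the combination of cubic sums into `(q^{n²} - q^{n²-n}) /
    -- (q;q)_{2n}`.
    rw [sub_eq_iff_eq_add.mp hE, sub_eq_iff_eq_add.mp hH, lhsTerm, div_eq_mul_inv, ← invQFact,
      div_eq_mul_one_div q, mul_pow, zpow_sub₀ hq, zpow_natCast,
      show (n : ℤ) ^ 2 = ((n ^ 2 : ℕ) : ℤ) by push_cast; ring, zpow_natCast]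
    have := pow_ne_zero n hq
    generalize (1 / (x * y)) ^ n = z
    field_simp
    ring
  have hL := tendsto_sum_mul_qPoch_mul_invQFact hq hq1 (q / (x * y)) hl
  simp only [hfin] at hL
  have hR := ((tendsto_qPoch (q / x) hq1).mul (tendsto_qPoch (q / y) hq1)).mul
    ((((tendsto_tsum_mul_invQFact hq hq1 hS₁ fun j => 3 * j).sub
      (tendsto_tsum_mul_invQFact hq hq1 hS₂ fun j => 3 * j)).sub
      (tendsto_tsum_mul_invQFact hq hq1 hT₁ fun j => 3 * j + 1)).add
      (tendsto_tsum_mul_invQFact hq hq1 hT₂ fun j => 3 * j + 2))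
  -- One factor `1/(q;q)_∞` is common to both limits. `hxy` makes `(q/(xy);q)_∞` nonzero, so it can
  -- be divided out.
  have h := tendsto_nhds_unique hL hR
  have n1 := qPochInf_ne_zero hq1 (one_sub_mul_pow_ne_zero hq1)
  have n2 := qPochInf_ne_zero hq1 (one_sub_div_mul_pow_ne_zero (mul_ne_zero hx0 hy0) hxy)
  field_simp at h ⊢
  linear_combination h
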